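/- Let $\mathbb{K}$ be $\mathbb{R}$ or $\mathbb{C}$. For a semi-infinite matrix $A=(A_{i,j})_{i,j\ge 0}$ over $\mathbb{K}$ put $\tau_n(A)=\det(A_{i,j})_{i,j=0}^{n-1}$, $\tau_0(A)=1$, and let $\Lambda=(\delta_{i+1,j})_{i,j\ge0}$ be the shift matrix. Let $m=m(t)=(m_{i,j}(t))_{i,j\ge 0}$ be a family of symmetric matrices over $\mathbb{K}$ depending on (real or complex) times $t=(t_1,t_2,\dots)$ in a set $U$ that is open in the $t_1$-direction, such that $\tau_n(m(t))\neq0$ for all $n\ge 0$ and $t\in U$, and such that the commuting flows $$\partial_{t_k}m=\Lambda^k m+m(\Lambda^{\top})^k,\qquad\text{i.e.}\quad \partial_{t_k}m_{i,j}=m_{i+k,j}+m_{i,j+k}\qquad(k\ge 1),$$ hold on $U$ (this is the 2d-Toda moment matrix $m(t,s)$ under the symmetric reduction and the constraint $s=-t$; the derivative in $t_k$ is taken within $U$, so that for $k\ge2$ the flow is only required along the variations of $t_k$ allowed by $U$). Let $m=S_1^{-1}S_2$ be the Gauss--Borel decomposition, with $S_1(t)$ lower triangular with unit diagonal and $S_2(t)$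 upper triangular with nonzero diagonal. Assume the rank one shift condition: there is a vector $\alpha(t)=(\alpha_0(t),\alpha_1(t),\dots)^{\top}$ with $$\Lambda m(t)+m(t)\Lambda^{\top}=\alpha(t)\alpha(t)^{\top}\qquad (t\in U).$$ Put $\tilde\tau_n(t)=\tau_n(m(t))$ (the symmetric tau functions), $\sigma=(\sigma_0,\sigma_1,\dots)^\top=S_1\alpha$ and $\tilde\sigma_n=\tilde\tau_n\sigma_n$. Then for all $n\ge0$ and all $t\in U$ the C-Toda lattice equations $$D_{t_1}\tilde\tau_{n+1}\cdot\tilde\tau_n=\tilde\sigma_n^2,\qquad D_{t_1}^2\,\tilde\tau_{n+1}\cdot\tilde\tau_{n+1}=4\,\tilde\sigma_n\tilde\sigma_{n+1}$$ hold, where $D_{t_k}^p f\cdot g=\left.\frac{\partial^p}{\partial x^p}\,f(\dots,t_k+x,\dots)\,g(\dots,t_k-x,\dots)\right|_{x=0}$ is the Hirota operator. -/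

import Mathlib

open scoped Topology

namespace CToda

section Matrices

variable {K : Type*} [Field K]

/-- The product `Λ ^ k * A`, where `Λ = (δ_{i+1,j})` is the semi-infinite shift matrix. -/
def shiftRows (k : ℕ) (A : Matrix ℕ ℕ K) : Matrix ℕ ℕ K :=
  Matrix.of fun i j => A (i + k) j

/-- The product `A * (Λᵀ) ^ k`. -/
def shiftCols (k : ℕ) (A : Matrix ℕ ℕ K) : Matrix ℕ ℕ K :=
  Matrix.of fun i j => A i (j + k)

/-- `tau n A = det (A i j)_{0 ≤ i, j ≤ n - 1}`, with `tau 0 A = 1`. -/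
def tau (n : ℕ) (A : Matrix ℕ ℕ K) : K :=
  (Matrix.of fun i j : Fin n => A i j).det

/-- A semi-infinite matrix is a moment matrix if all its (leading) principal minors are nonzero. -/
def IsMomentMatrix (A : Matrix ℕ ℕ K) : Prop :=
  ∀ n, tau n A ≠ 0

/-- The determinant of the `i × i` matrix with rows `0, …, i` except row `j`, and columns
`0, …, i - 1`, of `A`. -/
def tauMinor (A : Matrix ℕ ℕ K) (i : ℕ) (j : Fin (i + 1)) : K :=
  (Matrix.of fun a b : Fin i => A (j.succAbove a) b).det

/-- The Gauss–Borel decomposition `A = S₁⁻¹ * S₂`, with `S₁` lower triangular with unit diagonal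
and `S₂` upper triangular with nonzero diagonal. It is written as `S₁ * A = S₂`; row `i` of `S₁`
vanishes beyond column `i`, so the sum is the full matrix product. -/
structure IsBorelDecomposition (A S₁ S₂ : Matrix ℕ ℕ K) : Prop where
  lower : ∀ i j, i < j → S₁ i j = 0
  lower_diag : ∀ i, S₁ i i = 1
  upper : ∀ i j, j < i → S₂ i j = 0
  upper_diag : ∀ i, S₂ i i ≠ 0
  mul_eq : ∀ i k, ∑ j ∈ Finset.range (i + 1), S₁ i j * A j k = S₂ i k

/-- The factor `S₁` of the Gauss–Borel decomposition `A = S₁⁻¹ * S₂` of a moment matrix,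
given by minors; see `exists_isBorelDecomposition` and `IsBorelDecomposition.eq_borelLower`. -/
def borelLower (A : Matrix ℕ ℕ K) : Matrix ℕ ℕ K :=
  Matrix.of fun i j =>
    if h : j < i + 1 then (-1) ^ (i + j) * tauMinor A i ⟨j, h⟩ / tau i A else 0

/-- The vector `σ = S₁ α`. -/
def sigma (A : Matrix ℕ ℕ K) (a : ℕ → K) (n : ℕ) : K :=
  ∑ j ∈ Finset.range (n + 1), borelLower A n j * a j

/-- The rank one shift condition `Λ A + A Λᵀ = a aᵀ`. -/
def RankOneShift (A : Matrix ℕ ℕ K) (a : ℕ → K) : Prop :=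
  shiftRows 1 A + shiftCols 1 A = Matrix.vecMulVec a a

theorem borelLower_mul (A : Matrix ℕ ℕ K) (i k : ℕ) :
    ∑ j ∈ Finset.range (i + 1), borelLower A i j * A j k =
      (Matrix.of fun a b : Fin (i + 1) => A a (if (b : ℕ) < i then (b : ℕ) else k)).det
        / tau i A := by
  rw [Matrix.det_succ_column _ (Fin.last i), Finset.sum_range, Finset.sum_div]
  refine Finset.sum_congr rfl fun j _ => ?_
  have hsub : ((Matrix.of fun a b : Fin (i + 1) =>
      A a (if (b : ℕ) < i then (b : ℕ) else k)).submatrix j.succAbove (Fin.last i).succAbove).det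
      = tauMinor A i j := by
    unfold tauMinor
    congr 1
    ext a b
    simp [Matrix.submatrix]
  rw [hsub]
  simp only [borelLower, Matrix.of_apply, j.isLt, dif_pos, Fin.val_last, lt_irrefl, if_false]
  rw [add_comm i (j : ℕ)]
  ring

/-- Every moment matrix has a Gauss–Borel decomposition, with first factor `borelLower A`. -/
theorem exists_isBorelDecomposition {A : Matrix ℕ ℕ K} (hA : IsMomentMatrix A) :
    ∃ S₂, IsBorelDecomposition A (borelLower A) S₂ := by
  refine ⟨Matrix.of fun i k => ∑ j ∈ Finset.range (i + 1), borelLower A i j * A j k,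
    ?_, ?_, ?_, ?_, fun _ _ => rfl⟩
  · intro i j hij
    simp only [borelLower, Matrix.of_apply]
    rw [dif_neg (by omega)]
  · intro i
    have h : tauMinor A i ⟨i, Nat.lt_succ_self i⟩ = tau i A := by
      unfold tauMinor tau
      congr 1
      ext a b
      have : (⟨i, Nat.lt_succ_self i⟩ : Fin (i + 1)) = Fin.last i := rfl
      simp [this]
    simp only [borelLower, Matrix.of_apply]
    rw [dif_pos (Nat.lt_succ_self i), h, ← two_mul, pow_mul]
    simp [hA i]
  · intro i k hk
    rw [Matrix.of_apply, borelLower_mul]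
    rw [Matrix.det_zero_of_column_eq (i := ⟨k, by omega⟩) (j := Fin.last i), zero_div]
    · intro h
      have := congrArg Fin.val h
      simp at this
      omega
    · intro a
      simp [hk]
  · intro i
    rw [Matrix.of_apply, borelLower_mul]
    refine div_ne_zero ?_ (hA i)
    have h := hA (i + 1)
    unfold tau at h
    have e : (Matrix.of fun a b : Fin (i + 1) => A a (if (b : ℕ) < i then (b : ℕ) else i)) =
        Matrix.of fun a b : Fin (i + 1) => A a b := by
      ext a b
      have hb : (if (b : ℕ) < i then (b : ℕ) else i) = b := by
        have := b.isLt
        split_ifs <;> omega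
      simp only [Matrix.of_apply, hb]
    rwa [e]

/-- The first factor of a Gauss–Borel decomposition of a moment matrix is unique. -/
theorem IsBorelDecomposition.eq_borelLower {A S₁ S₂ : Matrix ℕ ℕ K} (hA : IsMomentMatrix A)
    (h : IsBorelDecomposition A S₁ S₂) : S₁ = borelLower A := by
  obtain ⟨T, hT⟩ := exists_isBorelDecomposition hA
  ext i j
  rcases lt_trichotomy i j with hij | rfl | hij
  · rw [h.lower i j hij, hT.lower i j hij]
  · rw [h.lower_diag, hT.lower_diag]
  · have key : (fun a : Fin i => S₁ i a - borelLower A i a) = 0 := by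
      refine Matrix.eq_zero_of_vecMul_eq_zero (hA i) ?_
      ext k
      have h1 := (h.mul_eq i k).trans (h.upper i k k.isLt)
      have h2 := (hT.mul_eq i k).trans (hT.upper i k k.isLt)
      rw [Finset.sum_range_succ, h.lower_diag] at h1
      rw [Finset.sum_range_succ, hT.lower_diag] at h2
      rw [Finset.sum_range] at h1 h2
      simp only [Matrix.vecMul, dotProduct, Matrix.of_apply, sub_mul, Finset.sum_sub_distrib,
        Pi.zero_apply]
      linear_combination h1 - h2
    exact sub_eq_zero.mp (congrFun key ⟨j, hij⟩)

end Matrices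

section Flows

variable {𝕜 K : Type*} [RCLike 𝕜] [RCLike K] [NormedAlgebra 𝕜 K]

/-- The Hirota operator
`D_{t_k}^p f · g = (∂/∂x)^p [f(t_k + x) g(t_k - x)]` at `x = 0`, for functions of the times
`t = (t_1, t_2, …)`. -/
noncomputable def hirota (k : ℕ+) (p : ℕ) (f g : (ℕ+ → 𝕜) → K) (t : ℕ+ → 𝕜) : K :=
  iteratedDeriv p (fun x : 𝕜 => f (t + Pi.single k x) * g (t - Pi.single k x)) 0

/-- A symmetric moment matrix `m(t)` with the commuting flows
`∂_{t_k} m = Λ^k m + m (Λᵀ)^k`, for times `t` in a set `U` on which `t_1` varies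
freely. The derivative in `t_k` is taken within `U`; for `k = 1` it is thus a genuine (two-sided)
derivative, and for `k ≥ 2` it may be one-sided, or void if `t_k` is frozen in `U`. -/
structure IsSymmetricFlow (U : Set (ℕ+ → 𝕜)) (m : (ℕ+ → 𝕜) → Matrix ℕ ℕ K) : Prop where
  open_fst : ∀ t ∈ U, ∀ᶠ x in 𝓝 (0 : 𝕜), t + Pi.single 1 x ∈ U
  moment : ∀ t ∈ U, IsMomentMatrix (m t)
  symm : ∀ t ∈ U, (m t).IsSymm
  flow : ∀ t ∈ U, ∀ (k : ℕ+) (i j : ℕ),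
    HasDerivWithinAt (fun x : 𝕜 => m (t + Pi.single k x) i j)
      ((shiftRows k (m t) + shiftCols k (m t)) i j) {x | t + Pi.single k x ∈ U} 0

/-- The symmetric tau functions `τ̃_n(t) = τ_n(t, -t)`: the tau functions of the moment matrix
`m(t) = m(t, -t)` obtained from the two-dimensional Toda times `(t, s)` by setting `s = -t`. -/
def symTau (m : (ℕ+ → 𝕜) → Matrix ℕ ℕ K) (n : ℕ) (t : ℕ+ → 𝕜) : K :=
  tau n (m t)

/-- `σ̃_n = τ̃_n σ_n`, where `σ = S₁ α`. -/
def symSigma (m : (ℕ+ → 𝕜) → Matrix ℕ ℕ K) (α : (ℕ+ → 𝕜) → ℕ → K) (n : ℕ) (t : ℕ+ → 𝕜) : K :=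
  symTau m n t * sigma (m t) (α t) n

end Flows

end CToda

/-!
Along the `t_1`-direction the rank one shift condition turns the flow into `m' = α αᵀ`. Write `M`
for the leading block of `m` of size `n`, `x` for the solution of `M x = α` (with `α` truncated)
and `ℓ_n` for the logarithmic derivative of `τ_n`. Jacobi's formula gives
`ℓ_n = tr (M⁻¹ M') = α · x`, and one further differentiation gives
`ℓ_n' = tr (M⁻¹ M'') - tr (M⁻¹ M' M⁻¹ M') = 2 (Λ α) · x - (α · x)²`.
The vector `α` is only determined up to sign at each time and need not be differentiable, so
it is the entries of `m'`, which the flow expresses through entries of `m`, that are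
differentiated.

In terms of logarithmic derivatives the Hirota expressions are
`D τ_{n+1} · τ_n = τ_{n+1} τ_n (ℓ_{n+1} - ℓ_n)` and `D² τ_n · τ_n = 2 τ_n² ℓ_n'`, so everything
reduces to linear algebra at a fixed time. Pairing the rows of the lower triangular Gauss–Borel
factor with `M x = α` (for a block of size `n + 1`) yields
`σ_n = (τ_{n+1} / τ_n) x_n` (`sigma_eq_of_solves`) and
`σ_{n+1} = α_{n+1} - ∑ m_{n+1,j} x_j` (`sigma_eq_sub_of_solves`). The first equation is then
`ℓ_{n+1} - ℓ_n = x_n σ_n` (`dotProduct_solution_succ`). For the second, the quadratic form of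
`Λ m + m Λᵀ = α αᵀ` at `x` equals `(α · x)²`, and it also equals `2 (Λ α) · x` up to the boundary
term of the truncation, which is `2 x_n σ_{n+1}` (`two_mul_dotProduct_shift_sub_sq`).
-/

namespace CToda

section LinearAlgebra

variable {K : Type*} [Field K]

/-! ### The Gauss–Borel factor and truncated linear systems -/

/-- The leading principal `n × n` block of a semi-infinite matrix. -/
def leading (n : ℕ) (A : Matrix ℕ ℕ K) : Matrix (Fin n) (Fin n) K :=
  Matrix.of fun i j => A i j

/-- The truncated vector `x` solves the leading `n × n` system `A x = a`. -/
def Solves (A : Matrix ℕ ℕ K) (a : ℕ → K) {n : ℕ} (x : Fin n → K) : Prop :=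
  ∀ i, i < n → ∑ j : Fin n, A i j * x j = a i

theorem solves_leading_inv {A : Matrix ℕ ℕ K} {n : ℕ} (hA : tau n A ≠ 0) (a : ℕ → K) :
    Solves A a ((leading n A)⁻¹.mulVec fun i => a i) := by
  intro i hi
  have h : (leading n A).mulVec ((leading n A)⁻¹.mulVec fun i => a i) = fun i : Fin n => a i := by
    rw [Matrix.mulVec_mulVec,
      Matrix.mul_nonsing_inv (leading n A) (isUnit_iff_ne_zero.2 hA : IsUnit (leading n A).det),
      Matrix.one_mulVec]
  exact congrFun h ⟨i, hi⟩

theorem borelLower_mul_of_lt {A : Matrix ℕ ℕ K} (hA : IsMomentMatrix A) {n k : ℕ} (hk : k < n) :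
    ∑ j ∈ Finset.range (n + 1), borelLower A n j * A j k = 0 := by
  obtain ⟨T, hT⟩ := exists_isBorelDecomposition hA
  rw [hT.mul_eq, hT.upper n k hk]

theorem borelLower_mul_self (A : Matrix ℕ ℕ K) (n : ℕ) :
    ∑ j ∈ Finset.range (n + 1), borelLower A n j * A j n = tau (n + 1) A / tau n A := by
  rw [borelLower_mul, tau]
  congr 3
  ext a b
  have hb : (if (b : ℕ) < n then (b : ℕ) else n) = b := by
    have := b.isLt
    split_ifs <;> omega
  simp only [hb]

theorem sigma_eq_of_solves {A : Matrix ℕ ℕ K} (hA : IsMomentMatrix A) {a : ℕ → K} {n : ℕ}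
    {x : Fin (n + 1) → K} (hx : Solves A a x) :
    sigma A a n = tau (n + 1) A / tau n A * x (Fin.last n) := by
  calc sigma A a n
      = ∑ j ∈ Finset.range (n + 1), borelLower A n j * ∑ k : Fin (n + 1), A j k * x k :=
        Finset.sum_congr rfl fun j hj => by rw [hx j (Finset.mem_range.1 hj)]
    _ = ∑ k : Fin (n + 1), (∑ j ∈ Finset.range (n + 1), borelLower A n j * A j k) * x k := by
        simp only [Finset.mul_sum, Finset.sum_mul, mul_assoc]
        exact Finset.sum_comm
    _ = tau (n + 1) A / tau n A * x (Fin.last n) := by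
        rw [Fin.sum_univ_castSucc, Finset.sum_eq_zero, Fin.val_last, borelLower_mul_self, zero_add]
        intro k _
        rw [Fin.val_castSucc, borelLower_mul_of_lt hA k.isLt, zero_mul]

theorem sigma_eq_sub_of_solves {A : Matrix ℕ ℕ K} (hA : IsMomentMatrix A) {a : ℕ → K} {n : ℕ}
    {x : Fin n → K} (hx : Solves A a x) :
    sigma A a n = a n - ∑ j : Fin n, A n j * x j := by
  obtain ⟨T, hT⟩ := exists_isBorelDecomposition hA
  have h0 : ∑ k : Fin n, (∑ j ∈ Finset.range (n + 1), borelLower A n j * A j k) * x k = 0 :=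
    Finset.sum_eq_zero fun k _ => by rw [borelLower_mul_of_lt hA k.isLt, zero_mul]
  have h1 : ∑ j ∈ Finset.range (n + 1), borelLower A n j * ∑ k : Fin n, A j k * x k = 0 := by
    rw [← h0]
    simp only [Finset.mul_sum, Finset.sum_mul, mul_assoc]
    exact Finset.sum_comm
  rw [Finset.sum_range_succ, hT.lower_diag, one_mul,
    Finset.sum_congr rfl fun j hj => by rw [hx j (Finset.mem_range.1 hj)]] at h1
  rw [sigma, Finset.sum_range_succ, hT.lower_diag]
  linear_combination h1

/-- The increment of `aᵀ A_n⁻¹ a` when the leading block grows by one row and column. -/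
theorem dotProduct_solution_succ {A : Matrix ℕ ℕ K} (hA : IsMomentMatrix A) (hs : A.IsSymm)
    {a : ℕ → K} {n : ℕ} {x : Fin (n + 1) → K} {y : Fin n → K} (hx : Solves A a x)
    (hy : Solves A a y) :
    ∑ i : Fin (n + 1), a i * x i - ∑ i : Fin n, a i * y i = x (Fin.last n) * sigma A a n := by
  have key : ∑ k : Fin n, a k * x k.castSucc =
      ∑ j : Fin n, y j * (a j - A n j * x (Fin.last n)) := by
    calc ∑ k : Fin n, a k * x k.castSucc
        = ∑ k : Fin n, (∑ j : Fin n, A k j * y j) * x k.castSucc :=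
          Finset.sum_congr rfl fun k _ => by rw [hy k k.isLt]
      _ = ∑ j : Fin n, y j * ∑ k : Fin n, A j k * x k.castSucc := by
          simp only [Finset.mul_sum, Finset.sum_mul]
          rw [Finset.sum_comm]
          refine Finset.sum_congr rfl fun j _ => Finset.sum_congr rfl fun k _ => ?_
          rw [hs.apply]
          ring
      _ = _ := by
          refine Finset.sum_congr rfl fun j _ => ?_
          have := hx j (by omega)
          rw [Fin.sum_univ_castSucc] at this
          simp only [Fin.val_castSucc, Fin.val_last] at this
          rw [← this, hs.apply j n]
          ring
  rw [Fin.sum_univ_castSucc]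
  simp only [Fin.val_castSucc, Fin.val_last]
  rw [key, sigma_eq_sub_of_solves hA hy]
  simp only [mul_sub, Finset.sum_sub_distrib, Finset.mul_sum]
  have e1 : ∑ j : Fin n, y j * a j = ∑ j : Fin n, a j * y j :=
    Finset.sum_congr rfl fun j _ => mul_comm _ _
  have e2 : ∑ j : Fin n, y j * (A n j * x (Fin.last n)) =
      ∑ j : Fin n, x (Fin.last n) * (A n j * y j) :=
    Finset.sum_congr rfl fun j _ => by ring
  rw [e1, e2]
  ring

theorem RankOneShift.apply {A : Matrix ℕ ℕ K} {a : ℕ → K} (h : RankOneShift A a) (i j : ℕ) :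
    A (i + 1) j + A i (j + 1) = a i * a j :=
  congrFun (congrFun h i) j

/-- The truncation of the shift to a leading block leaves a boundary term, which is a product
of the last coordinate of the solution and the next component of `σ`. -/
theorem two_mul_dotProduct_shift_sub_sq {A : Matrix ℕ ℕ K} (hA : IsMomentMatrix A)
    (hs : A.IsSymm) {a : ℕ → K} (h : RankOneShift A a) {n : ℕ} {x : Fin (n + 1) → K}
    (hx : Solves A a x) :
    2 * ∑ i : Fin (n + 1), a (i + 1) * x i - (∑ i : Fin (n + 1), a i * x i) ^ 2 =
      2 * x (Fin.last n) * sigma A a (n + 1) := by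
  have h1 : (∑ i : Fin (n + 1), a i * x i) ^ 2 = 2 * ∑ i, x i * ∑ j : Fin (n + 1), A (i + 1) j * x j := by
    have e : ∑ i, x i * ∑ j : Fin (n + 1), A (i + 1) j * x j =
        ∑ i : Fin (n + 1), ∑ j : Fin (n + 1), x i * x j * A i (j + 1) := by
      simp only [Finset.mul_sum]
      rw [Finset.sum_comm]
      refine Finset.sum_congr rfl fun j _ => Finset.sum_congr rfl fun i _ => ?_
      rw [hs.apply]
      ring
    rw [two_mul]
    nth_rw 2 [e]
    rw [sq, Finset.sum_mul_sum, ← Finset.sum_add_distrib]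
    refine Finset.sum_congr rfl fun i _ => ?_
    rw [Finset.mul_sum, ← Finset.sum_add_distrib]
    refine Finset.sum_congr rfl fun j _ => ?_
    linear_combination -(x i * x j) * h.apply i j
  rw [h1, sigma_eq_sub_of_solves hA hx, Fin.sum_univ_castSucc,
    Fin.sum_univ_castSucc (f := fun i => x i * ∑ j : Fin (n + 1), A (i + 1) j * x j)]
  have h2 : ∑ i : Fin n, x i.castSucc * ∑ j : Fin (n + 1), A (i.castSucc + 1) j * x j =
      ∑ i : Fin n, a (i.castSucc + 1) * x i.castSucc :=
    Finset.sum_congr rfl fun i _ => by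
      rw [Fin.val_castSucc, hx (i + 1) (by omega), mul_comm]
  rw [h2]
  simp only [Fin.val_last]
  ring

end LinearAlgebra

section Calculus

variable {𝕜 K : Type*} [NontriviallyNormedField 𝕜] [NormedField K] [NormedAlgebra 𝕜 K]

/-! ### Derivatives of determinants and inverses -/

variable {ι : Type*} [Fintype ι]

theorem hasDerivAt_matrix_mul {M N : 𝕜 → Matrix ι ι K} {M' N' : Matrix ι ι K} {x : 𝕜}
    (hM : ∀ i j, HasDerivAt (fun y => M y i j) (M' i j) x)
    (hN : ∀ i j, HasDerivAt (fun y => N y i j) (N' i j) x) (i j : ι) :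
    HasDerivAt (fun y => (M y * N y) i j) ((M' * N x + M x * N') i j) x := by
  simp only [Matrix.mul_apply, Matrix.add_apply, ← Finset.sum_add_distrib]
  exact HasDerivAt.fun_sum fun k _ => (hM i k).mul (hN k j)

variable [DecidableEq ι]

/-- Jacobi's formula. -/
theorem hasDerivAt_det {M : 𝕜 → Matrix ι ι K} {M' : Matrix ι ι K} {x : 𝕜}
    (h : ∀ i j, HasDerivAt (fun y => M y i j) (M' i j) x) :
    HasDerivAt (fun y => (M y).det) ((M x).adjugate * M').trace x := by
  have e : ((M x).adjugate * M').trace = ∑ σ : Equiv.Perm ι, ((Equiv.Perm.sign σ : ℤ) : K) *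
      ∑ i, (∏ j ∈ Finset.univ.erase i, M x (σ j) j) * M' (σ i) i := by
    have : ((M x).adjugate * M').trace = ∑ i, ((M x).updateCol i (M'.col i)).det := by
      refine Finset.sum_congr rfl fun i _ => ?_
      rw [← Matrix.cramer_apply, Matrix.cramer_eq_adjugate_mulVec]
      rfl
    rw [this]
    simp only [Matrix.det_apply', Finset.mul_sum]
    rw [Finset.sum_comm]
    refine Finset.sum_congr rfl fun σ _ => Finset.sum_congr rfl fun i _ => ?_
    rw [← Finset.prod_erase_mul _ _ (Finset.mem_univ i), Matrix.updateCol_self]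
    congr 2
    refine Finset.prod_congr rfl fun j hj => ?_
    rw [Matrix.updateCol_ne (Finset.ne_of_mem_erase hj)]
  rw [e]
  simp only [Matrix.det_apply']
  refine HasDerivAt.fun_sum fun σ _ => HasDerivAt.const_mul _ ?_
  simpa using HasDerivAt.fun_finsetProd (u := Finset.univ) fun i _ => h (σ i) i

theorem hasDerivAt_det_of_ne_zero {M : 𝕜 → Matrix ι ι K} {M' : Matrix ι ι K} {x : 𝕜}
    (h : ∀ i j, HasDerivAt (fun y => M y i j) (M' i j) x) (h0 : (M x).det ≠ 0) :
    HasDerivAt (fun y => (M y).det) ((M x).det * ((M x)⁻¹ * M').trace) x := by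
  convert hasDerivAt_det h using 1
  rw [Matrix.inv_def, Matrix.smul_mul, Matrix.trace_smul, smul_eq_mul, Ring.inverse_eq_inv',
    mul_inv_cancel_left₀ h0]

theorem hasDerivAt_matrix_inv {M : 𝕜 → Matrix ι ι K} {M' : Matrix ι ι K} {x : 𝕜}
    (h : ∀ i j, HasDerivAt (fun y => M y i j) (M' i j) x) (h0 : (M x).det ≠ 0) (i j : ι) :
    HasDerivAt (fun y => (M y)⁻¹ i j) ((-((M x)⁻¹ * M' * (M x)⁻¹)) i j) x := by
  have hdet := hasDerivAt_det h
  -- The cofactor formula shows that the inverse is differentiable; `M⁻¹ M = 1` gives the value.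
  have hdiff : ∀ i j, DifferentiableAt 𝕜 (fun y => (M y)⁻¹ i j) x := by
    intro i j
    have hadj : DifferentiableAt 𝕜 (fun y => ((M y).updateRow j (Pi.single i 1)).det) x := by
      refine (hasDerivAt_det (M' := M'.updateRow j 0) fun k l => ?_).differentiableAt
      by_cases hk : k = j
      · subst hk
        simpa only [Matrix.updateRow_self, Pi.zero_apply] using hasDerivAt_const x _
      · simpa only [Matrix.updateRow_ne hk] using h k l
    have := (hdet.differentiableAt.inv h0).mul hadj
    refine this.congr_of_eventuallyEq (Filter.Eventually.of_forall fun y => ?_)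
    simp [Matrix.inv_def, Matrix.adjugate_apply]
  set D : Matrix ι ι K := Matrix.of fun i j => deriv (fun y => (M y)⁻¹ i j) x with hD
  have hder : ∀ i j, HasDerivAt (fun y => (M y)⁻¹ i j) (D i j) x :=
    fun i j => (hdiff i j).hasDerivAt
  have hzero : D * M x + (M x)⁻¹ * M' = 0 := by
    ext i j
    refine (hasDerivAt_matrix_mul hder h i j).unique ?_
    refine (hasDerivAt_const x ((1 : Matrix ι ι K) i j)).congr_of_eventuallyEq ?_
    filter_upwards [hdet.continuousAt.eventually_ne h0] with y hy
    rw [Matrix.nonsing_inv_mul _ (isUnit_iff_ne_zero.2 hy)]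
  have hval : D = -((M x)⁻¹ * M' * (M x)⁻¹) := by
    rw [← Matrix.neg_mul, ← eq_neg_of_add_eq_zero_left hzero,
      Matrix.mul_nonsing_inv_cancel_right _ _ (isUnit_iff_ne_zero.2 h0)]
  rw [← hval]
  exact hder i j

theorem hasDerivAt_trace_inv_mul {M N : 𝕜 → Matrix ι ι K} {M' N' : Matrix ι ι K} {x : 𝕜}
    (hM : ∀ i j, HasDerivAt (fun y => M y i j) (M' i j) x)
    (hN : ∀ i j, HasDerivAt (fun y => N y i j) (N' i j) x) (h0 : (M x).det ≠ 0) :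
    HasDerivAt (fun y => ((M y)⁻¹ * N y).trace)
      (((M x)⁻¹ * N').trace - ((M x)⁻¹ * M' * (M x)⁻¹ * N x).trace) x := by
  have e : ((M x)⁻¹ * N').trace - ((M x)⁻¹ * M' * (M x)⁻¹ * N x).trace =
      (-((M x)⁻¹ * M' * (M x)⁻¹) * N x + (M x)⁻¹ * N').trace := by
    rw [Matrix.trace_add, Matrix.neg_mul, Matrix.trace_neg]
    ring
  rw [e]
  exact HasDerivAt.fun_sum fun i _ =>
    hasDerivAt_matrix_mul (hasDerivAt_matrix_inv hM h0) hN i i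

/-! ### Hirota derivatives through logarithmic derivatives -/

theorem deriv_mul_comp_neg {f g : 𝕜 → K} {f' g' : K} {x : 𝕜} (hf : HasDerivAt f f' x)
    (hg : HasDerivAt g g' (-x)) :
    HasDerivAt (fun y => f y * g (-y)) (f' * g (-x) - f x * g') x := by
  refine (hf.mul (hg.scomp x (hasDerivAt_neg x))).congr_deriv ?_
  simp [sub_eq_add_neg]

/-- If `f' = f ℓ` near `0`, then `(d/dx)² f(x) f(-x) = 2 f(0)² ℓ'(0)` at `0`. -/
theorem iteratedDeriv_two_mul_comp_neg {f l : 𝕜 → K} {l' : K}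
    (hf : ∀ᶠ x in 𝓝 (0 : 𝕜), HasDerivAt f (f x * l x) x) (hl : HasDerivAt l l' 0) :
    iteratedDeriv 2 (fun x => f x * f (-x)) 0 = 2 * f 0 ^ 2 * l' := by
  have hneg : Filter.Tendsto (fun x : 𝕜 => -x) (𝓝 0) (𝓝 0) := by
    simpa using (continuous_neg (G := 𝕜)).tendsto 0
  have h1 : deriv (fun x => f x * f (-x)) =ᶠ[𝓝 0] fun x => f x * f (-x) * (l x - l (-x)) := by
    filter_upwards [hf, hneg.eventually hf] with x hx hx'
    rw [(deriv_mul_comp_neg hx hx').deriv]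
    ring
  have hf0 := hf.self_of_nhds
  have hl' : HasDerivAt l l' (-0) := by simpa using hl
  have hF := deriv_mul_comp_neg hf0 (by simpa using hf0 : HasDerivAt f (f 0 * l 0) (-0))
  have hL : HasDerivAt (fun x => l x - l (-x)) (l' + l') 0 := by
    refine (hl.sub (hl'.scomp (0 : 𝕜) (hasDerivAt_neg (0 : 𝕜)))).congr_deriv ?_
    simp
  rw [iteratedDeriv_succ, iteratedDeriv_one, h1.deriv_eq]
  refine (hF.mul hL).deriv.trans ?_
  simp only [neg_zero]
  ring

end Calculus

section Flow

variable {𝕜 K : Type*} [RCLike 𝕜] [RCLike K] [NormedAlgebra 𝕜 K]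
  {U : Set (ℕ+ → 𝕜)} {m : (ℕ+ → 𝕜) → Matrix ℕ ℕ K} {α : (ℕ+ → 𝕜) → ℕ → K}

/-! ### The tau functions along the first flow -/

theorem IsSymmetricFlow.hasDerivAt (hm : IsSymmetricFlow U m) {t : ℕ+ → 𝕜} {x : 𝕜}
    (hx : t + Pi.single 1 x ∈ U) (i j : ℕ) :
    HasDerivAt (fun y : 𝕜 => m (t + Pi.single 1 y) i j)
      (m (t + Pi.single 1 x) (i + 1) j + m (t + Pi.single 1 x) i (j + 1)) x := by
  have h := (hm.flow _ hx 1 i j).hasDerivAt (hm.open_fst _ hx)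
  have h' : HasDerivAt (fun y : 𝕜 => m (t + Pi.single 1 x + Pi.single 1 y) i j)
      (m (t + Pi.single 1 x) (i + 1) j + m (t + Pi.single 1 x) i (j + 1)) (x - x) := by
    rw [sub_self]
    exact h
  refine (h'.comp_sub_const x x).congr_of_eventuallyEq (Filter.Eventually.of_forall fun y => ?_)
  simp only [add_assoc, ← Pi.single_add, add_sub_cancel]

/-- The logarithmic derivative of `τ_n(A)` along the first flow, as given by Jacobi's formula:
`tr (M⁻¹ M')` with `M` the leading block of `A` and `M'` that of `Λ A + A Λᵀ`. -/
noncomputable def logDerivTau (n : ℕ) (A : Matrix ℕ ℕ K) : K :=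
  ((leading n A)⁻¹ * leading n (shiftRows 1 A + shiftCols 1 A)).trace

theorem logDerivTau_eq {A : Matrix ℕ ℕ K} {a : ℕ → K} (h : RankOneShift A a) (n : ℕ) :
    logDerivTau n A = ∑ i : Fin n, a i * (leading n A)⁻¹.mulVec (fun i => a i) i := by
  have : leading n (shiftRows 1 A + shiftCols 1 A) =
      Matrix.vecMulVec (fun i : Fin n => a i) (fun i : Fin n => a i) := by
    rw [h]
    rfl
  rw [logDerivTau, this, Matrix.mul_vecMulVec, Matrix.trace_vecMulVec, dotProduct_comm]
  rfl

theorem IsSymmetricFlow.hasDerivAt_symTau (hm : IsSymmetricFlow U m) {t : ℕ+ → 𝕜} {x : 𝕜}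
    (hx : t + Pi.single 1 x ∈ U) (n : ℕ) :
    HasDerivAt (fun y : 𝕜 => symTau m n (t + Pi.single 1 y))
      (symTau m n (t + Pi.single 1 x) * logDerivTau n (m (t + Pi.single 1 x))) x := by
  have hM : ∀ i j, HasDerivAt (fun y : 𝕜 => leading n (m (t + Pi.single 1 y)) i j)
      (leading n (shiftRows 1 (m (t + Pi.single 1 x)) + shiftCols 1 (m (t + Pi.single 1 x))) i j)
      x := fun i j => hm.hasDerivAt hx i j
  have h0 : (leading n (m (t + Pi.single 1 x))).det ≠ 0 := hm.moment _ hx n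
  exact hasDerivAt_det_of_ne_zero hM h0

theorem IsSymmetricFlow.hasDerivAt_logDerivTau (hm : IsSymmetricFlow U m) {t : ℕ+ → 𝕜}
    (ht : t ∈ U) (hα : RankOneShift (m t) (α t)) (n : ℕ) :
    HasDerivAt (fun y : 𝕜 => logDerivTau n (m (t + Pi.single 1 y)))
      (2 * ∑ i : Fin n, α t (i + 1) * (leading n (m t))⁻¹.mulVec (fun i => α t i) i -
        (∑ i : Fin n, α t i * (leading n (m t))⁻¹.mulVec (fun i => α t i) i) ^ 2) 0 := by
  have h0 : t + Pi.single (1 : ℕ+) (0 : 𝕜) = t := by simp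
  have ht0 : t + Pi.single (1 : ℕ+) (0 : 𝕜) ∈ U := by rwa [h0]
  set a : Fin n → K := fun i => α t i
  set b : Fin n → K := fun i => α t (i + 1)
  set G := (leading n (m t))⁻¹ with hG
  have hGs : G.IsSymm := by
    have : (leading n (m t)).IsSymm := Matrix.IsSymm.ext fun i j => (hm.symm t ht).apply i j
    rw [hG, Matrix.IsSymm, Matrix.transpose_nonsing_inv, this.eq]
  have hM : ∀ i j, HasDerivAt (fun y : 𝕜 => leading n (m (t + Pi.single 1 y)) i j)
      (Matrix.vecMulVec a a i j) 0 := by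
    intro i j
    have := hm.hasDerivAt ht0 i j
    rw [h0, hα.apply] at this
    exact this
  -- `m''ᵢⱼ = m'ᵢ₊₁,ⱼ + m'ᵢ,ⱼ₊₁` is computed by applying the flow twice, then the rank one condition.
  have hN : ∀ i j, HasDerivAt (fun y : 𝕜 => leading n (shiftRows 1 (m (t + Pi.single 1 y)) +
      shiftCols 1 (m (t + Pi.single 1 y))) i j)
      ((Matrix.vecMulVec b a + Matrix.vecMulVec a b) i j) 0 := by
    intro i j
    have := (hm.hasDerivAt ht0 (i + 1) j).add (hm.hasDerivAt ht0 i (j + 1))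
    rw [h0, hα.apply, hα.apply] at this
    exact this
  have key := hasDerivAt_trace_inv_mul hM hN (by rw [h0]; exact hm.moment t ht n)
  have hN0 : leading n (shiftRows 1 (m t) + shiftCols 1 (m t)) = Matrix.vecMulVec a a := by
    rw [hα]
    rfl
  rw [h0, hN0] at key
  refine key.congr_deriv ?_
  have hab : dotProduct (G.mulVec b) a = dotProduct b (G.mulVec a) := by
    rw [dotProduct_comm, Matrix.dotProduct_mulVec, ← Matrix.mulVec_transpose, hGs.eq,
      dotProduct_comm]
  change (G * _).trace - (G * _ * G * _).trace =
    2 * dotProduct b (G.mulVec a) - dotProduct a (G.mulVec a) ^ 2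
  rw [Matrix.mul_add, Matrix.trace_add, Matrix.mul_assoc (G * _) G]
  simp only [Matrix.mul_vecMulVec, Matrix.trace_vecMulVec, Matrix.vecMulVec_mulVec, hab,
    smul_dotProduct]
  rw [dotProduct_comm (G.mulVec a) b, dotProduct_comm (G.mulVec a) a, op_smul_eq_mul]
  ring

end Flow

end CToda

theorem mainTheorem2 {𝕜 K : Type*} [RCLike 𝕜] [RCLike K] [NormedAlgebra 𝕜 K]
    (U : Set (ℕ+ → 𝕜)) (m : (ℕ+ → 𝕜) → Matrix ℕ ℕ K) (α : (ℕ+ → 𝕜) → ℕ → K)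
    (hm : CToda.IsSymmetricFlow U m)
    (hα : ∀ t ∈ U, CToda.RankOneShift (m t) (α t)) :
    ∀ t ∈ U, ∀ n : ℕ,
      CToda.hirota 1 1 (CToda.symTau m (n + 1)) (CToda.symTau m n) t =
          CToda.symSigma m α n t * CToda.symSigma m α n t ∧
        CToda.hirota 1 2 (CToda.symTau m (n + 1)) (CToda.symTau m (n + 1)) t =
          4 * CToda.symSigma m α n t * CToda.symSigma m α (n + 1) t := by
  intro t ht n
  have hA := hm.moment t ht
  have hs := hm.symm t ht
  have hr := hα t ht
  have h0 : t + Pi.single (1 : ℕ+) (0 : 𝕜) = t := by simp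
  have hsub : ∀ x : 𝕜, t - Pi.single (1 : ℕ+) x = t + Pi.single 1 (-x) := fun x => by
    rw [Pi.single_neg, sub_eq_add_neg]
  have hx := CToda.solves_leading_inv (hA (n + 1)) (α t)
  have hy := CToda.solves_leading_inv (hA n) (α t)
  have hσ := CToda.sigma_eq_of_solves hA hx
  have hτ := hA n
  have hτ' := hA (n + 1)
  have h0U : t + Pi.single (1 : ℕ+) (0 : 𝕜) ∈ U := by rwa [h0]
  simp only [CToda.hirota, hsub]
  constructor
  · rw [iteratedDeriv_one]
    have h1 := hm.hasDerivAt_symTau h0U (n + 1)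
    have h2 := hm.hasDerivAt_symTau h0U n
    refine (CToda.deriv_mul_comp_neg h1 (by rwa [neg_zero])).deriv.trans ?_
    simp only [neg_zero, h0, CToda.logDerivTau_eq hr]
    have key := CToda.dotProduct_solution_succ hA hs hx hy
    simp only [CToda.symSigma, CToda.symTau]
    field_simp at hσ
    linear_combination CToda.tau (n + 1) (m t) * CToda.tau n (m t) * key -
      CToda.tau n (m t) * CToda.sigma (m t) (α t) n * hσ
  · refine (CToda.iteratedDeriv_two_mul_comp_neg (f := fun x => CToda.symTau m (n + 1)
      (t + Pi.single 1 x)) ((hm.open_fst t ht).mono fun x hx => hm.hasDerivAt_symTau hx (n + 1))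
      (hm.hasDerivAt_logDerivTau ht hr (n + 1))).trans ?_
    rw [h0, CToda.two_mul_dotProduct_shift_sub_sq hA hs hr hx]
    simp only [CToda.symSigma, CToda.symTau]
    field_simp at hσ
    linear_combination -4 * CToda.tau (n + 1) (m t) *
      CToda.sigma (m t) (α t) (n + 1) * hσ
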